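/- Let $K$ be a field with prime subfield $k$ (so $k=\mathbb Q$ or $k=\mathbb F_p$), let $\tilde k\subseteq K$ be a subfield, let $L$ be a field and $\tilde l\subseteq L$ a subfield that is algebraically closed in $L$. For elements $x_1,x_2$ of $K^\times/k^\times$ (respectively of $L^\times/\tilde l^\times$) write $x_1\sim x_2$ if lifts of them generate an extension of $\tilde k$ (respectively of $\tilde l$) of transcendence degree at most $1$. Put $A:=L^\times/\tilde l^\times$, regard $\mathbb P(K):=K^\times/k^\times$ as a projective space over $k$, and let $$\psi:\mathbb P(K)=K^\times/k^\times\to A$$ be a group homomorphism such that $x_1\sim x_2$ implies $\psi(x_1)\sim\psi(x_2)$. A map $f$ from a projective line $\mathfrak l$ over a field to a set is called a linear flag map if it is constant on $\mathfrak l\setminus\{\mathfrak q\}$ for some point $\mathfrak q\in\mathfrak l$. If $k=\mathbb Q$, a map $f$ on a line $\mathfrak l\simeq\mathbb P^1(\mathbb Q)$ is said to be induced from a map $\bar f$ on $\mathbb P^1(\mathbb Z/p)$, $p$ a prime, if $f=\bar f\circ\rho$, where $\rho:\mathfrak l\to\mathbb P^1(\mathbb Z/p)$ is the reduction map given by some $\mathbb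 Z_{(p)}$-lattice $\mathbb Z_{(p)}^2\simeq B\subset\mathbb Q^2$. A map on a line over $k$ is a flag map if it is a linear flag map or if $k=\mathbb Q$ and it is induced from a linear flag map on $\mathbb P^1(\mathbb Z/p)$ for some prime $p$. A line $\mathfrak l\subset\mathbb P(K)$ is of type $(\mathrm F)$ if the restriction $\psi_{\mathfrak l}$ is a nonconstant flag map and is not induced (with $k=\mathbb Q$) from a map $\mathbb P^1(\mathbb Z/p)\to A$ for any prime $p$. Let $\mathfrak u\subset\mathbb P(K)$ be the union of all lines through $1$ on which $\psi$ is injective, and put $\mathfrak U:=\{xy\mid x,y\in\mathfrak u\}$. Assume that there are $y_1,y_2\in\psi(\mathfrak u)$ with $y_1\not\sim y_2$, and that $\mathbb P(K)$ contains a line of type $(\mathrm F)$. Then there exists a valuation $\nu$ of $K$ (a homomorphism from $K^\times$ onto a totally ordered abelian group satisfying the nonarchimedean triangle inequality), with valuation ring $\mathfrak o_\nu$ and maximal ideal $\mathfrak m_\nu$, such that the image of $\mathfrak o_\nu^\times$ in $K^\times/k^\times$ is contained in $\mathfrak U$ and $\psi$ is trivial on the image of $1+\mathfrak m_\nu$.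 -/

import Mathlib

open scoped LinearAlgebra.Projectivization

universe u v w

noncomputable section

namespace AlgDepHom

/-- The nonzero elements of a subfield `F` of `K`, as a subgroup of `Kˣ`. -/
def unitsOf {K : Type u} [Field K] (F : Subfield K) : Subgroup Kˣ :=
  (Units.map (F.subtype : F →* K)).range

theorem mem_unitsOf {K : Type u} [Field K] {F : Subfield K} {x : Kˣ} :
    x ∈ unitsOf F ↔ (x : K) ∈ F := by
  constructor
  · rintro ⟨y, rfl⟩
    exact (y : F).2
  · intro hx
    have hne : (⟨(x : K), hx⟩ : F) ≠ 0 := fun h => x.ne_zero (congrArg Subtype.val h)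
    exact ⟨Units.mk0 _ hne, Units.ext rfl⟩

/-- The prime subfield `k` of `K`. -/
abbrev PrimeField (K : Type u) [Field K] : Subfield K := ⊥

/-- The group `ℙ(K) = Kˣ / kˣ`, where `k` is the prime subfield of `K`. -/
abbrev PK (K : Type u) [Field K] : Type u := Kˣ ⧸ unitsOf (PrimeField K)

/-- Algebraic dependence with respect to the subfield `F` of two classes modulo a subgroup `H`
of `Kˣ`: lifts `x, y` satisfy `tr.deg_F F(x, y) ≤ 1`. It is used for subgroups `H` of `Fˣ`, for
which it does not depend on the lifts. -/
def AlgDep {K : Type u} [Field K] (F : Subfield K) {H : Subgroup Kˣ} (a b : Kˣ ⧸ H) : Prop :=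
  ∃ x y : Kˣ, (x : Kˣ ⧸ H) = a ∧ (y : Kˣ ⧸ H) = b ∧
    Algebra.trdeg F (IntermediateField.adjoin F {(x : K), (y : K)}) ≤ 1

/-- The homomorphism `ψ` preserves algebraic dependence with respect to `kt` and `lt`. -/
def PreservesAlgDep {K : Type u} [Field K] {L : Type v} [Field L] (kt : Subfield K)
    (lt : Subfield L) (ψ : PK K →* Lˣ ⧸ unitsOf lt) : Prop :=
  ∀ x₁ x₂ : PK K, AlgDep kt x₁ x₂ → AlgDep lt (ψ x₁) (ψ x₂)

/-- A projective line in `ℙ(K)` is given by a two-dimensional `k`-subspace of `K`. -/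
def IsLine {K : Type u} [Field K] (V : Submodule (PrimeField K) K) : Prop :=
  Module.finrank (PrimeField K) V = 2

/-- The points of `ℙ(K)` on the projective subspace given by `V`. -/
def points {K : Type u} [Field K] (V : Submodule (PrimeField K) K) : Set (PK K) :=
  {P | ∃ x : Kˣ, (x : K) ∈ V ∧ (x : PK K) = P}

/-- The restriction of a map `f` on `ℙ(K)` to the projective subspace given by `V`. -/
def restrict {K : Type u} [Field K] {A : Type w} (f : PK K → A)
    (V : Submodule (PrimeField K) K) : ℙ (PrimeField K) V → A :=
  Projectivization.lift
    (fun v : {v : V // v ≠ 0} =>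
      f (Units.mk0 ((v : V) : K) (fun h => v.2 (Subtype.ext h)) : Kˣ))
    (by
      rintro ⟨a, ha⟩ ⟨b, hb⟩ t h
      simp only at h
      have hbK : (b : K) ≠ 0 := fun h' => hb (Subtype.ext h')
      have haK : (a : K) ≠ 0 := fun h' => ha (Subtype.ext h')
      refine congrArg f (QuotientGroup.eq.2 (mem_unitsOf.2 ?_))
      have hab : (a : K) = (t : K) * (b : K) := by rw [h]; rfl
      have ht : (t : K) ≠ 0 := fun h' => haK (by rw [hab, h', zero_mul])
      have : ((Units.mk0 (a : K) haK)⁻¹ * Units.mk0 (b : K) hbK : Kˣ) = ((t : K))⁻¹ := by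
        simp only [Units.val_mul, Units.val_inv_eq_inv_val, Units.val_mk0]
        rw [hab]
        field_simp
      rw [this]
      exact inv_mem t.2)

/-- For a projective line `ℙ F V` (`dim V = 2`): there is a flag `ℙ¹ ⊃ ℙ⁰ = {q}` such that `f` is
constant on `ℙ¹ ∖ ℙ⁰`. -/
def IsLinearFlagMap {F : Type u} [Field F] {V : Type v} [AddCommGroup V] [Module F V]
    {A : Type w} (f : ℙ F V → A) : Prop :=
  ∃ (q : ℙ F V) (a : A), ∀ x : ℙ F V, x ≠ q → f x = a

/-- For a projective line `ℙ F V` over `F = ℚ` and a basis `e` of `V`, spanning the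
`ℤ_(p)`-lattice `B = ℤ_(p) e₀ ⊕ ℤ_(p) e₁`: the map `f` equals `fbar ∘ ρ_B`, where
`ρ_B : ℙ¹(ℚ) → ℙ¹(ℤ/p)` is the reduction map of `B`. Every point of `ℙ F V` has a
representative `m e₀ + n e₁` in `B ∖ pB` with integers `m, n`, and `ρ_B` maps it to
`[m mod p : n mod p]`. -/
def IsInducedVia {F : Type u} [Field F] {V : Type v} [AddCommGroup V] [Module F V]
    {A : Type w} (f : ℙ F V → A) (p : ℕ) [Fact p.Prime] (e : Module.Basis (Fin 2) F V)
    (fbar : ℙ (ZMod p) (Fin 2 → ZMod p) → A) : Prop :=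
  ∀ (m n : ℤ) (hv : (m : F) • e 0 + (n : F) • e 1 ≠ 0)
    (hred : (![(m : ZMod p), (n : ZMod p)] : Fin 2 → ZMod p) ≠ 0),
    f (Projectivization.mk F _ hv) = fbar (Projectivization.mk (ZMod p) _ hred)

/-- A map on a projective line over a prime field `F` is induced from a map on `ℙ¹(ℤ/p)`, for some
prime `p`, via some lattice. This only makes sense for `F = ℚ`. -/
def IsInduced {F : Type u} [Field F] {V : Type v} [AddCommGroup V] [Module F V]
    {A : Type w} (f : ℙ F V → A) : Prop :=
  CharZero F ∧ ∃ (p : ℕ) (_ : Fact p.Prime) (e : Module.Basis (Fin 2) F V)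
    (fbar : ℙ (ZMod p) (Fin 2 → ZMod p) → A), IsInducedVia f p e fbar

/-- Flag maps on a projective line over a prime field `F`. -/
def IsFlagMap {F : Type u} [Field F] {V : Type v} [AddCommGroup V] [Module F V]
    {A : Type w} (f : ℙ F V → A) : Prop :=
  IsLinearFlagMap f ∨
    (CharZero F ∧ ∃ (p : ℕ) (_ : Fact p.Prime) (e : Module.Basis (Fin 2) F V)
      (fbar : ℙ (ZMod p) (Fin 2 → ZMod p) → A), IsLinearFlagMap fbar ∧ IsInducedVia f p e fbar)

/-- The line given by `V` is of type (F) with respect to `f`: the restriction of `f` to it is not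
induced from a map on `ℙ¹(ℤ/p)` and is a nonconstant flag map. -/
def IsTypeF {K : Type u} [Field K] {A : Type w} (f : PK K → A)
    (V : Submodule (PrimeField K) K) : Prop :=
  IsLine V ∧ ¬ IsInduced (restrict f V) ∧ (¬ ∃ a : A, ∀ x, restrict f V x = a) ∧
    IsFlagMap (restrict f V)

/-- The union `𝔲` of all lines through `1` on which `f` is injective. -/
def smallU {K : Type u} [Field K] {A : Type w} (f : PK K → A) : Set (PK K) :=
  {P | ∃ V : Submodule (PrimeField K) K, IsLine V ∧ (1 : PK K) ∈ points V ∧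
    Function.Injective (restrict f V) ∧ P ∈ points V}

/-- The set `𝔘` of products of two elements of `𝔲`. -/
def bigU {K : Type u} [Field K] {A : Type w} (f : PK K → A) : Set (PK K) :=
  {P | ∃ x ∈ smallU f, ∃ y ∈ smallU f, P = x * y}

end AlgDepHom

end

/-!
Extend `ψ` by zero to a multiplicative map `f` on `K`, and call `x` injective if `f` is injective on
the line through `1` and `x`.

If `x` and `y` are injective with independent values, then so are `x + y` and `x * y`: a coincidence
`f (x + y + c) = f (x + y + d)` would have to depend on both `f x` and `f y`. As an injective
element independent of any two given values can be found, products of injective elements can be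
rearranged generically, so the products of two injective elements form a group `P`, and every
element of `P` with nontrivial value is again injective.

If `f` takes the same value, not `1`, at two of the points `x + c`, then `f` is constant on all of
them: the value is visible in `f (x + w)` for generic `w`. So a line on which `f` has three
different values is injective. Hence for `x ∉ P` and `v ∈ P` with `f x ≠ f v`, the value at `x + v`
is `f x` or `f v`. Applied to `1` this shows that `1 + x` or `1 + x⁻¹` is in `P`, and then
translation by `x`, respectively `x⁻¹`, preserves `P`. Therefore `P` is the group of units of a
valuation ring whose maximal ideal `𝔪` consists of the `x` with `x + P = P`. If `f (1 + x) ≠ f 1`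
for some `x ∈ 𝔪`, then the difference `x` of `1 + x` and `1` would lie in `P`, which is absurd.
-/

namespace AlgDepHom

section Rigid

open Pointwise

variable {K : Type u} [Field K] {P : Submonoid K} {x y : K}

/-- The elements of `K` such that the translations by them preserve `P`. If `P` is the group of
units of a valuation ring, they form its maximal ideal. -/
def infinitesimals (P : Submonoid K) : AddSubgroup K :=
  AddAction.stabilizer K (P : Set K)

theorem mem_infinitesimals : x ∈ infinitesimals P ↔ ∀ y, x + y ∈ P ↔ y ∈ P :=
  AddAction.mem_stabilizer_set

theorem mem_infinitesimals_of_forall_add_mem (hneg : -1 ∈ P) (h : ∀ y ∈ P, x + y ∈ P) :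
    x ∈ infinitesimals P := by
  have neg_mem : ∀ y ∈ P, -y ∈ P := fun y hy => by simpa using P.mul_mem hneg hy
  refine mem_infinitesimals.2 fun y => ⟨fun hxy => ?_, h y⟩
  simpa using neg_mem _ (h _ (neg_mem _ hxy))

theorem notMem_of_mem_infinitesimals (h₀ : 0 ∉ P) (hx : x ∈ infinitesimals P) : x ∉ P := by
  simpa [h₀] using mem_infinitesimals.1 hx 0

theorem mul_mem_infinitesimals_of_mem (h₀ : 0 ∉ P) (hinv : ∀ a ∈ P, a⁻¹ ∈ P)
    (hx : x ∈ infinitesimals P) (hy : y ∈ P) : x * y ∈ infinitesimals P := by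
  have hy₀ : y ≠ 0 := ne_of_mem_of_not_mem hy h₀
  have mul_mem_iff : ∀ a, a * y ∈ P ↔ a ∈ P := fun a =>
    ⟨fun h => by simpa [mul_assoc, hy₀] using P.mul_mem h (hinv y hy), fun h => P.mul_mem h hy⟩
  refine mem_infinitesimals.2 fun z => ?_
  obtain ⟨w, rfl⟩ : ∃ w, z = w * y := ⟨z / y, (div_mul_cancel₀ z hy₀).symm⟩
  rw [← add_mul, mul_mem_iff, mul_mem_iff, mem_infinitesimals.1 hx]

theorem mul_mem_infinitesimals (h₀ : 0 ∉ P) (hinv : ∀ a ∈ P, a⁻¹ ∈ P)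
    (hx : x ∈ infinitesimals P) (hy : y ∈ infinitesimals P) : x * y ∈ infinitesimals P := by
  have h := mul_mem_infinitesimals_of_mem h₀ hinv hx ((mem_infinitesimals.1 hy 1).2 P.one_mem)
  rw [mul_add, mul_one] at h
  simpa using (infinitesimals P).sub_mem h hx

/-- A multiplicative group of nonzero elements of `K` such that every other nonzero element, or its
inverse, is infinitesimal. These are the groups of units of the valuation rings of `K`. -/
structure IsRigid (P : Submonoid K) : Prop where
  zero_notMem : 0 ∉ P
  neg_one_mem : -1 ∈ P
  inv_mem : ∀ x ∈ P, x⁻¹ ∈ P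
  mem_infinitesimals_or : ∀ x, x ≠ 0 → x ∉ P → x ∈ infinitesimals P ∨ x⁻¹ ∈ infinitesimals P

namespace IsRigid

theorem add_mem_or_mem_infinitesimals (h : IsRigid P) (hx : x ∈ P) (hy : y ∈ P) :
    x + y ∈ P ∨ x + y ∈ infinitesimals P := by
  refine or_iff_not_imp_left.2 fun hP => ?_
  by_cases hxy : x + y = 0
  · exact hxy ▸ (infinitesimals P).zero_mem
  refine (h.mem_infinitesimals_or _ hxy hP).resolve_right fun hinv => ?_
  have one_mem : (x + y)⁻¹ * x + (x + y)⁻¹ * y ∈ infinitesimals P :=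
    add_mem (mul_mem_infinitesimals_of_mem h.zero_notMem h.inv_mem hinv hx)
      (mul_mem_infinitesimals_of_mem h.zero_notMem h.inv_mem hinv hy)
  rw [← mul_add, inv_mul_cancel₀ hxy] at one_mem
  exact notMem_of_mem_infinitesimals h.zero_notMem one_mem P.one_mem

/-- The valuation ring with group of units `P` and maximal ideal `infinitesimals P`. -/
def valuationSubring (h : IsRigid P) : ValuationSubring K where
  carrier := {x | x ∈ P ∨ x ∈ infinitesimals P}
  one_mem' := .inl P.one_mem
  zero_mem' := .inr (infinitesimals P).zero_mem
  mul_mem' {x y} hx hy := by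
    have mul_mem := fun {x y} => mul_mem_infinitesimals_of_mem (P := P) (x := x) (y := y)
      h.zero_notMem h.inv_mem
    rcases hx with hx | hx <;> rcases hy with hy | hy
    · exact .inl (P.mul_mem hx hy)
    · exact .inr (mul_comm y x ▸ mul_mem hy hx)
    · exact .inr (mul_mem hx hy)
    · exact .inr (mul_mem_infinitesimals h.zero_notMem h.inv_mem hx hy)
  add_mem' {x y} hx hy := by
    rcases hx with hx | hx <;> rcases hy with hy | hy
    · exact h.add_mem_or_mem_infinitesimals hx hy
    · exact .inl (add_comm y x ▸ (mem_infinitesimals.1 hy x).2 hx)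
    · exact .inl ((mem_infinitesimals.1 hx y).2 hy)
    · exact .inr (add_mem hx hy)
  neg_mem' {x} := Or.imp (fun hx => by simpa using P.mul_mem h.neg_one_mem hx) neg_mem
  mem_or_inv_mem' x := by
    by_cases hx₀ : x = 0
    · exact .inl (hx₀ ▸ .inr (infinitesimals P).zero_mem)
    by_cases hx : x ∈ P
    · exact .inl (.inl hx)
    · exact (h.mem_infinitesimals_or x hx₀ hx).imp .inr .inr

theorem mem_valuationSubring (h : IsRigid P) :
    x ∈ h.valuationSubring ↔ x ∈ P ∨ x ∈ infinitesimals P :=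
  Iff.rfl

theorem inv_notMem_valuationSubring (h : IsRigid P) (hx₀ : x ≠ 0) (hx : x ∈ infinitesimals P) :
    x⁻¹ ∉ h.valuationSubring := by
  have hxP := notMem_of_mem_infinitesimals h.zero_notMem hx
  rintro (hinv | hinv)
  · exact hxP (by simpa using h.inv_mem _ hinv)
  · have one_mem := mul_mem_infinitesimals h.zero_notMem h.inv_mem hx hinv
    rw [mul_inv_cancel₀ hx₀] at one_mem
    exact notMem_of_mem_infinitesimals h.zero_notMem one_mem P.one_mem

theorem mem_of_valuation_eq_one (h : IsRigid P) (hx : h.valuationSubring.valuation x = 1) :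
    x ∈ P := by
  have hx₀ : x ≠ 0 := by
    rintro rfl
    simp at hx
  refine (h.mem_valuationSubring.1 ((ValuationSubring.valuation_le_one_iff _ x).1 hx.le)
    ).resolve_right fun hxM => h.inv_notMem_valuationSubring hx₀ hxM ?_
  rw [← ValuationSubring.valuation_le_one_iff, map_inv₀, hx, inv_one]

theorem mem_infinitesimals_of_valuation_lt_one (h : IsRigid P)
    (hx : h.valuationSubring.valuation x < 1) : x ∈ infinitesimals P := by
  refine (h.mem_valuationSubring.1 ((ValuationSubring.valuation_le_one_iff _ x).1 hx.le)
    ).resolve_left fun hxP => ?_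
  have hx₀ : x ≠ 0 := ne_of_mem_of_not_mem hxP h.zero_notMem
  have hinv := (ValuationSubring.valuation_le_one_iff h.valuationSubring x⁻¹).2
    (.inl (h.inv_mem x hxP))
  rw [map_inv₀, inv_le_one₀ ((Valuation.pos_iff _).2 hx₀)] at hinv
  exact hinv.not_gt hx

end IsRigid

end Rigid

section Dependence

variable {K : Type u} [Field K] {G : Type v} [CommGroupWithZero G]

/-- The map `f` factors on `Kˣ` through `Kˣ / kˣ`. -/
def IsTrivialOn (k : Subfield K) (f : K →*₀ G) : Prop :=
  ∀ c ∈ k, c ≠ 0 → f c = 1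

/-- The map `f` is injective on the projective line over `k` through `1` and `x`, whose points are
`1` and the `x + c` with `c ∈ k`. -/
def LineInj (k : Subfield K) (f : K →*₀ G) (x : K) : Prop :=
  (∀ c ∈ k, f (x + c) ≠ 1) ∧ ∀ c ∈ k, ∀ d ∈ k, f (x + c) = f (x + d) → c = d

/-- The products of two elements on lines through `1` on which `f` is injective, that is, the
elements whose class lies in `𝔘`. -/
def ProdInj (k : Subfield K) (f : K →*₀ G) (x : K) : Prop :=
  ∃ u v, LineInj k f u ∧ LineInj k f v ∧ x = u * v

/-- A dependence relation on a group with zero: up to the trivial elements `0` and `1`, which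
depend on everything, the group is partitioned into subgroups. -/
structure IsDependence (D : G → G → Prop) : Prop where
  zero_left : ∀ b, D 0 b
  one_left : ∀ b, D 1 b
  refl : ∀ a, D a a
  symm : ∀ {a b}, D a b → D b a
  trans : ∀ {a b c}, b ≠ 0 → b ≠ 1 → D a b → D b c → D a c
  mul_right : ∀ {a b c}, D a b → D a c → D a (b * c)
  inv_right : ∀ {a b}, D a b → D a b⁻¹

/-- A multiplicative map, trivial on the subfield `k`, that maps the points of every line over `k`
through `1` to dependent elements. -/
structure IsDependenceHom (k : Subfield K) (f : K →*₀ G) (D : G → G → Prop) : Prop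
    extends IsDependence D where
  isTrivialOn : IsTrivialOn k f
  dep_add : ∀ x, ∀ c ∈ k, D (f x) (f (x + c))

/-- A dependence homomorphism that takes independent values on the lines through `1` on which it is
injective. -/
structure IsNondegenerateDependenceHom (k : Subfield K) (f : K →*₀ G) (D : G → G → Prop) : Prop
    extends IsDependenceHom k f D where
  exists_not_dep : ∃ a b, LineInj k f a ∧ LineInj k f b ∧ ¬ D (f a) (f b)

namespace IsTrivialOn

variable {k : Subfield K} {f : K →*₀ G} {a b c s x : K}

theorem map_neg (h : IsTrivialOn k f) (x : K) : f (-x) = f x := by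
  rw [← neg_one_mul, map_mul, h (-1) (k.neg_mem k.one_mem) (by simp), one_mul]

theorem map_mul_of_mem (h : IsTrivialOn k f) (hc : c ∈ k) (hc₀ : c ≠ 0) (x : K) :
    f (c * x) = f x := by
  rw [map_mul, h c hc hc₀, one_mul]

theorem map_inv_add (h : IsTrivialOn k f) (hx : x ≠ 0) (hc : c ∈ k) (hc₀ : c ≠ 0) :
    f (x⁻¹ + c) = f (x + c⁻¹) / f x := by
  rw [← h.map_mul_of_mem hc hc₀ (x + c⁻¹), ← map_div₀]
  congr 1
  field_simp
  ring

theorem notMem_of_map_add_eq (h : IsTrivialOn k f) (ha : a ∈ k) (hab : a ≠ b)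
    (hsab : f (s + a) = f (s + b)) (hsa : f (s + a) ≠ 1) : s ∉ k := fun hsk => hab (by
  have hsa₀ : s + a = 0 := not_not.1 fun hne => hsa (h _ (k.add_mem hsk ha) hne)
  rw [hsa₀, map_zero, eq_comm, map_eq_zero f] at hsab
  exact add_left_cancel (hsa₀.trans hsab.symm))

end IsTrivialOn

namespace LineInj

variable {k : Subfield K} {f : K →*₀ G} {c x : K}

theorem map_ne_one (hx : LineInj k f x) : f x ≠ 1 := by
  simpa using hx.1 0 k.zero_mem

theorem notMem (hx : LineInj k f x) : x ∉ k := fun hxk =>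
  hx.1 (1 - x) (k.sub_mem k.one_mem hxk) (by simp)

theorem ne_zero (hx : LineInj k f x) : x ≠ 0 := fun hx₀ => hx.notMem (hx₀ ▸ k.zero_mem)

theorem map_ne_zero (hx : LineInj k f x) : f x ≠ 0 := (_root_.map_ne_zero f).2 hx.ne_zero

theorem add_mem (hx : LineInj k f x) (hc : c ∈ k) : LineInj k f (x + c) := by
  refine ⟨fun d hd => ?_, fun d hd e he hde => ?_⟩
  · rw [add_assoc]
    exact hx.1 _ (k.add_mem hc hd)
  · rw [add_assoc, add_assoc] at hde
    exact add_left_cancel (hx.2 _ (k.add_mem hc hd) _ (k.add_mem hc he) hde)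

theorem map_add_ne (hx : LineInj k f x) (hc : c ∈ k) (hc₀ : c ≠ 0) : f (x + c) ≠ f x :=
  fun h => hc₀ (hx.2 c hc 0 k.zero_mem (by rwa [add_zero]))

theorem mul_of_mem (hf : IsTrivialOn k f) (hc : c ∈ k) (hc₀ : c ≠ 0) (hx : LineInj k f x) :
    LineInj k f (c * x) := by
  have map_add : ∀ d, f (c * x + d) = f (x + d / c) := fun d => by
    rw [← hf.map_mul_of_mem hc hc₀ (x + d / c), mul_add, mul_div_cancel₀ d hc₀]
  refine ⟨fun d hd => ?_, fun d hd e he hde => ?_⟩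
  · rw [map_add]
    exact hx.1 _ (k.div_mem hd hc)
  · rw [map_add, map_add] at hde
    exact (div_left_inj' hc₀).1 (hx.2 _ (k.div_mem hd hc) _ (k.div_mem he hc) hde)

theorem neg (hf : IsTrivialOn k f) (hx : LineInj k f x) : LineInj k f (-x) := by
  rw [← neg_one_mul]
  exact hx.mul_of_mem hf (k.neg_mem k.one_mem) (by simp)

theorem inv (hf : IsTrivialOn k f) (hx : LineInj k f x) : LineInj k f x⁻¹ := by
  have hfx := hx.map_ne_zero
  have map_add_ne_inv : ∀ c ∈ k, c ≠ 0 → f (x⁻¹ + c) ≠ f x⁻¹ := by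
    intro c hc hc₀ h
    rw [hf.map_inv_add hx.ne_zero hc hc₀, map_inv₀, div_eq_iff hfx, inv_mul_cancel₀ hfx] at h
    exact hx.1 _ (k.inv_mem hc) h
  refine ⟨fun c hc => ?_, fun c hc d hd hcd => ?_⟩
  · by_cases hc₀ : c = 0
    · simpa [hc₀] using hx.map_ne_one
    · rw [hf.map_inv_add hx.ne_zero hc hc₀, Ne, div_eq_one_iff_eq hfx]
      exact hx.map_add_ne (k.inv_mem hc) (inv_ne_zero hc₀)
  · by_cases hc₀ : c = 0
    · subst hc₀
      by_contra hd₀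
      exact map_add_ne_inv d hd (Ne.symm hd₀) (by simpa using hcd.symm)
    by_cases hd₀ : d = 0
    · subst hd₀
      exact absurd (by simpa using hcd) (map_add_ne_inv c hc hc₀)
    rw [hf.map_inv_add hx.ne_zero hc hc₀, hf.map_inv_add hx.ne_zero hd hd₀,
      div_left_inj' hfx] at hcd
    exact inv_injective (hx.2 _ (k.inv_mem hc) _ (k.inv_mem hd) hcd)

end LineInj

namespace ProdInj

variable {k : Subfield K} {f : K →*₀ G} {x : K}

theorem ne_zero (hx : ProdInj k f x) : x ≠ 0 := by
  obtain ⟨u, v, hu, hv, rfl⟩ := hx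
  exact mul_ne_zero hu.ne_zero hv.ne_zero

theorem map_ne_zero (hx : ProdInj k f x) : f x ≠ 0 := (_root_.map_ne_zero f).2 hx.ne_zero

theorem inv (hf : IsTrivialOn k f) (hx : ProdInj k f x) : ProdInj k f x⁻¹ := by
  obtain ⟨u, v, hu, hv, rfl⟩ := hx
  exact ⟨u⁻¹, v⁻¹, hu.inv hf, hv.inv hf, mul_inv u v⟩

theorem neg (hf : IsTrivialOn k f) (hx : ProdInj k f x) : ProdInj k f (-x) := by
  obtain ⟨u, v, hu, hv, rfl⟩ := hx
  exact ⟨-u, v, hu.neg hf, hv, (neg_mul u v).symm⟩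

end ProdInj

namespace IsDependence

variable {D : G → G → Prop} {a b c d : G}

theorem zero_right (h : IsDependence D) : D a 0 := h.symm (h.zero_left a)

theorem div_right (h : IsDependence D) (hb : D a b) (hc : D a c) : D a (b / c) := by
  rw [div_eq_mul_inv]
  exact h.mul_right hb (h.inv_right hc)

theorem not_symm (h : IsDependence D) (hab : ¬ D a b) : ¬ D b a := fun hba => hab (h.symm hba)

theorem ne (h : IsDependence D) (hab : ¬ D a b) : a ≠ b := fun e => hab (e ▸ h.refl a)

theorem ne_zero_left (h : IsDependence D) (hab : ¬ D a b) : a ≠ 0 :=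
  fun ha => hab (ha ▸ h.zero_left b)

theorem ne_zero_right (h : IsDependence D) (hab : ¬ D a b) : b ≠ 0 :=
  h.ne_zero_left (h.not_symm hab)

theorem ne_one_right (h : IsDependence D) (hab : ¬ D a b) : b ≠ 1 :=
  fun hb => hab (h.symm (hb ▸ h.one_left a))

theorem of_div_right (h : IsDependence D) (hc₀ : c ≠ 0) (hc : D a c) (hbc : D a (b / c)) :
    D a b := by
  simpa [div_mul_cancel₀ b hc₀] using h.mul_right hbc hc

theorem of_div_left (h : IsDependence D) (hb₀ : b ≠ 0) (hb : D a b) (hbc : D a (b / c)) :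
    D a c := by
  simpa [div_div_cancel₀ hb₀] using h.div_right hb hbc

theorem not_dep_of_dep (h : IsDependence D) (hab : ¬ D a b) (hac : D a c) (hc₀ : c ≠ 0)
    (hc₁ : c ≠ 1) : ¬ D c b :=
  fun hcb => hab (h.trans hc₀ hc₁ hac hcb)

theorem eq_one_of_dep (h : IsDependence D) (hab : ¬ D a b) (ha : D a c) (hb : D b c)
    (hc₀ : c ≠ 0) : c = 1 := by
  by_contra hc₁
  exact hab (h.trans hc₀ hc₁ ha (h.symm hb))

theorem not_dep_inv_right (h : IsDependence D) (hab : ¬ D a b) : ¬ D a b⁻¹ :=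
  fun hd => hab (by simpa using h.inv_right hd)

theorem not_dep_inv_left (h : IsDependence D) (hab : ¬ D a b) : ¬ D a⁻¹ b :=
  h.not_symm (h.not_dep_inv_right (h.not_symm hab))

theorem not_dep_mul_right (h : IsDependence D) (hab : ¬ D a b) : ¬ D a (a * b) := fun hd =>
  hab (by simpa [mul_div_cancel_left₀ b (h.ne_zero_left hab)] using h.div_right hd (h.refl a))

/-- Each of `c` and `d` is dependent on at most one of the pairwise independent elements `a`, `b`,
`a * b`. -/
theorem exists_not_dep_of_not_dep (h : IsDependence D) (hab : ¬ D a b) (hc₀ : c ≠ 0) (hc₁ : c ≠ 1)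
    (hd₀ : d ≠ 0) (hd₁ : d ≠ 1) :
    ∃ g, (g = a ∨ g = b ∨ g = a * b) ∧ ¬ D g c ∧ ¬ D g d := by
  have hac := h.not_dep_mul_right hab
  have hbc : ¬ D b (a * b) := mul_comm b a ▸ h.not_dep_mul_right (h.not_symm hab)
  have dep_of_dep : ∀ {e}, e ≠ 0 → e ≠ 1 → ∀ {g g'}, D g e → D g' e → D g g' :=
    fun he₀ he₁ _ _ hg hg' => h.trans he₀ he₁ hg (h.symm hg')
  by_contra! hall
  have dep_or : ∀ g, (g = a ∨ g = b ∨ g = a * b) → D g c ∨ D g d := fun g hg =>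
    or_iff_not_imp_left.2 (hall g hg)
  rcases dep_or a (by simp) with ha | ha <;> rcases dep_or b (by simp) with hb | hb <;>
    rcases dep_or (a * b) (by simp) with hm | hm <;>
    first
    | exact hab (dep_of_dep ‹_› ‹_› ha hb)
    | exact hac (dep_of_dep ‹_› ‹_› ha hm)
    | exact hbc (dep_of_dep ‹_› ‹_› hb hm)

end IsDependence

namespace IsDependenceHom

variable {k : Subfield K} {f : K →*₀ G} {D : G → G → Prop} {a b c s u v w x y : K} {g : G}

theorem dep_add_div (h : IsDependenceHom k f D) (hu : u ≠ 0) :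
    D (f (u + v) / f u) (f v / f u) := by
  rw [← map_div₀, ← map_div₀, add_div, div_self hu, add_comm]
  exact h.symm (h.dep_add (v / u) 1 k.one_mem)

theorem not_dep_add_mem (h : IsDependenceHom k f D) (hx : LineInj k f x) (hc : c ∈ k)
    (hxg : ¬ D (f x) g) : ¬ D (f (x + c)) g :=
  h.not_dep_of_dep hxg (h.dep_add x c hc) (hx.add_mem hc).map_ne_zero (hx.1 c hc)

theorem not_dep_add (h : IsDependenceHom k f D) (hx : LineInj k f x) (hy : LineInj k f y)
    (hxy : ¬ D (f x) (f y)) : ¬ D (f x) (f (x + y)) := by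
  intro hd
  have hne : x + y ≠ 0 := fun h₀ => h.ne hxy (by
    rw [eq_neg_of_add_eq_zero_left h₀, h.isTrivialOn.map_neg])
  -- `(x + y) / (x + c)` depends on `x` and on `(y - c) / (x + c)`, which are independent.
  have map_add_eq : ∀ c ∈ k, f (x + y) = f (x + c) := by
    intro c hc
    have hxc := hx.add_mem hc
    have dep_x : D (f x) (f (x + y) / f (x + c)) := h.div_right hd (h.dep_add x c hc)
    have dep_y : D (f (y + -c) / f (x + c)) (f (x + y) / f (x + c)) := by
      have := h.dep_add_div (v := y + -c) hxc.ne_zero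
      rw [show x + c + (y + -c) = x + y by ring] at this
      exact h.symm this
    have not_dep : ¬ D (f x) (f (y + -c) / f (x + c)) := fun hd' =>
      h.not_dep_add_mem hy (k.neg_mem hc) (h.not_symm hxy)
        (h.symm (h.of_div_right hxc.map_ne_zero (h.dep_add x c hc) hd'))
    exact (div_eq_one_iff_eq hxc.map_ne_zero).1 (h.eq_one_of_dep not_dep dep_x dep_y
      (div_ne_zero ((map_ne_zero f).2 hne) hxc.map_ne_zero))
  refine hx.map_add_ne k.one_mem one_ne_zero ?_
  rw [← map_add_eq 1 k.one_mem, map_add_eq 0 k.zero_mem, add_zero]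

theorem map_add_mem_add_ne (h : IsDependenceHom k f D) (hx : LineInj k f x) (hy : LineInj k f y)
    (hxy : ¬ D (f x) (f y)) (hc : c ∈ k) (hc₀ : c ≠ 0) : f (x + c + y) ≠ f (x + y) := by
  intro hcy
  have hxc := hx.add_mem hc
  have hy₀ := hy.map_ne_zero
  have hz : ¬ D (f y) (f (x + y)) := add_comm y x ▸ h.not_dep_add hy hx (h.not_symm hxy)
  have dep_c := h.dep_add_div (v := x + c) hy.ne_zero
  have dep_0 := h.dep_add_div (v := x) hy.ne_zero
  rw [add_comm y, hcy] at dep_c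
  rw [add_comm y] at dep_0
  have dep_div : D (f (x + c) / f y) (f (x + c) / f x) := by
    have := h.div_right (h.refl _) (h.trans (div_ne_zero (h.ne_zero_right hz) hy₀)
      (mt (div_eq_one_iff_eq hy₀).1 (h.ne hz).symm) (h.symm dep_c) dep_0)
    rwa [div_div_div_cancel_right₀ hy₀] at this
  have dep_x : D (f (x + c)) (f (x + c) / f x) :=
    h.div_right (h.refl _) (h.symm (h.dep_add x c hc))
  have dep_y : D (f (x + c)) (f (x + c) / f y) :=
    h.trans (div_ne_zero hxc.map_ne_zero hx.map_ne_zero)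
      (mt (div_eq_one_iff_eq hx.map_ne_zero).1 (hx.map_add_ne hc hc₀)) dep_x (h.symm dep_div)
  exact h.not_dep_add_mem hx hc hxy (h.of_div_left hxc.map_ne_zero (h.refl _) dep_y)

theorem lineInj_add (h : IsDependenceHom k f D) (hx : LineInj k f x) (hy : LineInj k f y)
    (hxy : ¬ D (f x) (f y)) : LineInj k f (x + y) := by
  have not_dep : ∀ c ∈ k, ¬ D (f (x + c)) (f y) := fun c hc => h.not_dep_add_mem hx hc hxy
  refine ⟨fun c hc => ?_, fun c hc d hd hcd => ?_⟩
  · rw [add_right_comm]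
    exact h.ne_one_right (h.not_dep_add (hx.add_mem hc) hy (not_dep c hc))
  · by_contra hne
    refine h.map_add_mem_add_ne (hx.add_mem hd) hy (not_dep d hd) (k.sub_mem hc hd)
      (sub_ne_zero.2 hne) ?_
    rw [add_right_comm x y, add_right_comm x y] at hcd
    rwa [add_assoc x, add_sub_cancel]

theorem lineInj_mul (h : IsDependenceHom k f D) (hx : LineInj k f x) (hy : LineInj k f y)
    (hxy : ¬ D (f x) (f y)) : LineInj k f (x * y) := by
  have hf := h.isTrivialOn
  have hyi := hy.inv hf
  have hxyi : ¬ D (f x) (f y⁻¹) := map_inv₀ f y ▸ h.not_dep_inv_right hxy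
  have lineInj_add_mul : ∀ c ∈ k,
      LineInj k f (x + c * y⁻¹) ∧ ¬ D (f (x + c * y⁻¹)) (f y⁻¹) := by
    intro c hc
    by_cases hc₀ : c = 0
    · simpa only [hc₀, zero_mul, add_zero] using And.intro hx hxyi
    · have hcy := hyi.mul_of_mem hf hc hc₀
      have hxcy : ¬ D (f x) (f (c * y⁻¹)) := by rwa [hf.map_mul_of_mem hc hc₀]
      have not_dep := h.not_dep_add hcy hx (h.not_symm hxcy)
      rw [hf.map_mul_of_mem hc hc₀, add_comm] at not_dep
      exact ⟨h.lineInj_add hx hcy hxcy, h.not_symm not_dep⟩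
  have map_mul_add : ∀ c, f (x * y + c) = f (x + c * y⁻¹) * f y := fun c => by
    rw [← map_mul, add_mul, inv_mul_cancel_right₀ hy.ne_zero]
  refine ⟨fun c hc he => ?_, fun c hc d hd hcd => ?_⟩
  · rw [map_mul_add] at he
    refine h.ne (lineInj_add_mul c hc).2 ?_
    rw [map_inv₀, eq_inv_of_mul_eq_one_left he]
  · by_contra hne
    have hdc : d - c ∈ k := k.sub_mem hd hc
    have hdc₀ : d - c ≠ 0 := sub_ne_zero.2 (Ne.symm hne)
    have not_dep := h.not_dep_add (lineInj_add_mul c hc).1 (hyi.mul_of_mem hf hdc hdc₀)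
      (by rw [hf.map_mul_of_mem hdc hdc₀]; exact (lineInj_add_mul c hc).2)
    rw [map_mul_add, map_mul_add, mul_left_inj' hy.map_ne_zero] at hcd
    rw [show x + c * y⁻¹ + (d - c) * y⁻¹ = x + d * y⁻¹ by ring, ← hcd] at not_dep
    exact not_dep (h.refl _)

theorem map_add_lineInj_of_map_add_eq (h : IsDependenceHom k f D) (ha : a ∈ k) (hb : b ∈ k)
    (hab : a ≠ b) (hsab : f (s + a) = f (s + b)) (hw : LineInj k f w)
    (hws : ¬ D (f w) (f (s + a))) : f (s + w) = f (s + a) := by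
  by_contra hne
  have hsa : s + a ≠ 0 := (map_ne_zero f).1 (h.ne_zero_right hws)
  have hsb : s + b ≠ 0 := (map_ne_zero f).1 (hsab ▸ h.ne_zero_right hws)
  have hwa := hw.add_mem (k.neg_mem ha)
  have hwb := hw.add_mem (k.neg_mem hb)
  have hs₀ := (map_ne_zero f).2 hsa
  have not_dep_a := h.not_dep_add_mem hw (k.neg_mem ha) hws
  have hsw₀ : s + w ≠ 0 := fun h₀ => h.ne not_dep_a (by
    rw [← h.isTrivialOn.map_neg]
    congr 1
    linear_combination -h₀)
  have dep_a := h.dep_add_div (v := w + -a) hsa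
  have dep_b := h.dep_add_div (v := w + -b) hsb
  rw [show s + a + (w + -a) = s + w by ring] at dep_a
  rw [show s + b + (w + -b) = s + w by ring, ← hsab] at dep_b
  have dep_div : D (f (w + -a) / f (s + a)) (f (w + -a) / f (w + -b)) := by
    have := h.div_right (h.refl _) (h.trans (div_ne_zero ((map_ne_zero f).2 hsw₀) hs₀)
      (mt (div_eq_one_iff_eq hs₀).1 hne) (h.symm dep_a) dep_b)
    rwa [div_div_div_cancel_right₀ hs₀] at this
  have dep_wa : D (f (w + -a)) (f (w + -a) / f (w + -b)) :=
    h.div_right (h.refl _) (h.trans hw.map_ne_zero hw.map_ne_one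
      (h.symm (h.dep_add w _ (k.neg_mem ha))) (h.dep_add w _ (k.neg_mem hb)))
  have div_ne_one : f (w + -a) / f (w + -b) ≠ 1 :=
    mt (div_eq_one_iff_eq hwb.map_ne_zero).1 fun he =>
      hab (neg_injective (hw.2 _ (k.neg_mem ha) _ (k.neg_mem hb) he))
  exact not_dep_a (h.of_div_left hwa.map_ne_zero (h.refl _)
    (h.trans (div_ne_zero hwa.map_ne_zero hwb.map_ne_zero) div_ne_one dep_wa (h.symm dep_div)))

end IsDependenceHom

namespace IsNondegenerateDependenceHom

variable {k : Subfield K} {f : K →*₀ G} {D : G → G → Prop} {a b d s u v w x y : K} {g₁ g₂ : G}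

theorem exists_lineInj_not_dep₂ (h : IsNondegenerateDependenceHom k f D) (h₁₀ : g₁ ≠ 0)
    (h₁₁ : g₁ ≠ 1) (h₂₀ : g₂ ≠ 0) (h₂₁ : g₂ ≠ 1) :
    ∃ w, LineInj k f w ∧ ¬ D (f w) g₁ ∧ ¬ D (f w) g₂ := by
  obtain ⟨a, b, ha, hb, hab⟩ := h.exists_not_dep
  obtain ⟨_, rfl | rfl | rfl, hg⟩ := h.exists_not_dep_of_not_dep hab h₁₀ h₁₁ h₂₀ h₂₁
  · exact ⟨a, ha, hg⟩
  · exact ⟨b, hb, hg⟩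
  · exact ⟨a * b, h.lineInj_mul ha hb hab, by rwa [map_mul]⟩

theorem exists_lineInj_not_dep (h : IsNondegenerateDependenceHom k f D) (h₀ : g₁ ≠ 0)
    (h₁ : g₁ ≠ 1) : ∃ w, LineInj k f w ∧ ¬ D (f w) g₁ := by
  obtain ⟨w, hw, hwg, -⟩ := h.exists_lineInj_not_dep₂ h₀ h₁ h₀ h₁
  exact ⟨w, hw, hwg⟩

theorem prodInj_of_lineInj (h : IsNondegenerateDependenceHom k f D) (hx : LineInj k f x) :
    ProdInj k f x := by
  obtain ⟨w, hw, hwx⟩ := h.exists_lineInj_not_dep hx.map_ne_zero hx.map_ne_one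
  exact ⟨x * w, w⁻¹, h.lineInj_mul hx hw (h.not_symm hwx), hw.inv h.isTrivialOn,
    (mul_inv_cancel_right₀ hw.ne_zero x).symm⟩

theorem prodInj_lineInj_mul (h : IsNondegenerateDependenceHom k f D) (hx : LineInj k f x)
    (hy : ProdInj k f y) : ProdInj k f (x * y) := by
  obtain ⟨u, v, hu, hv, rfl⟩ := hy
  by_cases huv : D (f u) (f v)
  · obtain ⟨w, hw, hwx, hwu⟩ :=
      h.exists_lineInj_not_dep₂ hx.map_ne_zero hx.map_ne_one hu.map_ne_zero hu.map_ne_one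
    have huw : ¬ D (f u) (f w⁻¹) := map_inv₀ f w ▸ h.not_dep_inv_right (h.not_symm hwu)
    have huwv : ¬ D (f (u * w⁻¹)) (f v) := h.not_symm <|
      h.not_dep_of_dep (map_mul f u w⁻¹ ▸ h.not_dep_mul_right huw) huv hv.map_ne_zero hv.map_ne_one
    refine ⟨x * w, u * w⁻¹ * v, h.lineInj_mul hx hw (h.not_symm hwx),
      h.lineInj_mul (h.lineInj_mul hu (hw.inv h.isTrivialOn) huw) hv huwv, ?_⟩
    field_simp [hw.ne_zero]
  · exact ⟨x, u * v, hx, h.lineInj_mul hu hv huv, rfl⟩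

theorem prodInj_mul (h : IsNondegenerateDependenceHom k f D) (hx : ProdInj k f x)
    (hy : ProdInj k f y) : ProdInj k f (x * y) := by
  obtain ⟨u, v, hu, hv, rfl⟩ := hx
  rw [mul_assoc]
  exact h.prodInj_lineInj_mul hu (h.prodInj_lineInj_mul hv hy)

theorem prodInj_div (h : IsNondegenerateDependenceHom k f D) (hx : ProdInj k f x)
    (hy : ProdInj k f y) : ProdInj k f (x / y) :=
  div_eq_mul_inv x y ▸ h.prodInj_mul hx (hy.inv h.isTrivialOn)

theorem prodInj_one (h : IsNondegenerateDependenceHom k f D) : ProdInj k f 1 := by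
  obtain ⟨a, -, ha, -⟩ := h.exists_not_dep
  exact ⟨a, a⁻¹, ha, ha.inv h.isTrivialOn, (mul_inv_cancel₀ ha.ne_zero).symm⟩

/-- The group of products of elements on injective lines; it will be the group of units of the
valuation ring. -/
def prodInjSubmonoid (h : IsNondegenerateDependenceHom k f D) : Submonoid K where
  carrier := {x | ProdInj k f x}
  mul_mem' := h.prodInj_mul
  one_mem' := h.prodInj_one

theorem lineInj_of_prodInj (h : IsNondegenerateDependenceHom k f D) (hx : ProdInj k f x)
    (hx₁ : f x ≠ 1) : LineInj k f x := by
  obtain ⟨u, v, hu, hv, rfl⟩ := id hx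
  by_cases huv : D (f u) (f v)
  · obtain ⟨w, hw, hwu⟩ := h.exists_lineInj_not_dep hu.map_ne_zero hu.map_ne_one
    have huw := h.not_symm hwu
    have hwv : ¬ D (f w⁻¹) (f v) := h.not_symm <|
      h.not_dep_of_dep (map_inv₀ f w ▸ h.not_dep_inv_right huw) huv hv.map_ne_zero hv.map_ne_one
    have huwv : u * w * (w⁻¹ * v) = u * v := by field_simp [hw.ne_zero]
    have dep_u : D (f (u * v)) (f u) := by
      rw [map_mul]
      exact h.symm (h.mul_right (h.refl _) huv)
    have not_dep : ¬ D (f (u * v)) (f (u * w)) := fun hd =>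
      h.not_dep_mul_right huw (map_mul f u w ▸ h.trans hx.map_ne_zero hx₁ (h.symm dep_u) hd)
    rw [← huwv]
    refine h.lineInj_mul (h.lineInj_mul hu hw huw)
      (h.lineInj_mul (hw.inv h.isTrivialOn) hv hwv) fun hd => not_dep (h.symm ?_)
    rw [← huwv, map_mul f (u * w)]
    exact h.mul_right (h.refl _) hd
  · exact h.lineInj_mul hu hv huv

theorem prodInj_add (h : IsNondegenerateDependenceHom k f D) (hx : ProdInj k f x)
    (hy : ProdInj k f y) (hxy : f x ≠ f y) : ProdInj k f (x + y) := by
  have hdiv : LineInj k f (x / y) := h.lineInj_of_prodInj (h.prodInj_div hx hy) (by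
    rwa [map_div₀, Ne, div_eq_one_iff_eq hy.map_ne_zero])
  have := h.prodInj_mul (h.prodInj_of_lineInj (hdiv.add_mem k.one_mem)) hy
  rwa [add_mul, div_mul_cancel₀ _ hy.ne_zero, one_mul] at this

theorem prodInj_sub (h : IsNondegenerateDependenceHom k f D) (hx : ProdInj k f x)
    (hy : ProdInj k f y) (hxy : f x ≠ f y) : ProdInj k f (x - y) := by
  rw [sub_eq_add_neg]
  exact h.prodInj_add hx (hy.neg h.isTrivialOn) (by rwa [h.isTrivialOn.map_neg])

/-- Compare the values at `s + w⁻¹` and `s⁻¹ + w = s⁻¹ * w * (s + w⁻¹)` for generic `w`. -/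
theorem map_add_eq_one_of_map_eq_one (h : IsNondegenerateDependenceHom k f D) (hs : f s = 1)
    (ha : a ∈ k) (ha₀ : a ≠ 0) (hb : b ∈ k) (hb₀ : b ≠ 0) (hab : a ≠ b)
    (hsab : f (s + a) = f (s + b)) : f (s + a) = 1 := by
  have hs₀ : s ≠ 0 := (map_ne_zero f).1 (hs ▸ one_ne_zero)
  have hsa₀ : f (s + a) ≠ 0 := fun h₀ => hab (by
    have hsa : s + a = 0 := (map_eq_zero f).1 h₀
    exact add_left_cancel (hsa.trans ((map_eq_zero f).1 (hsab ▸ h₀)).symm))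
  by_contra hsa
  obtain ⟨w, hw, hws⟩ := h.exists_lineInj_not_dep hsa₀ hsa
  have map_add_inv : f (s + w⁻¹) = f (s + a) :=
    h.map_add_lineInj_of_map_add_eq ha hb hab hsab (hw.inv h.isTrivialOn)
      (map_inv₀ f w ▸ h.not_dep_inv_left hws)
  have map_inv_add : ∀ c ∈ k, c ≠ 0 → f (s⁻¹ + c⁻¹) = f (s + c) := fun c hc hc₀ => by
    rw [h.isTrivialOn.map_inv_add hs₀ (k.inv_mem hc) (inv_ne_zero hc₀), inv_inv, hs, div_one]
  have map_inv_add_w : f (s⁻¹ + w) = f (s + a) := by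
    rw [← map_inv_add a ha ha₀] at hws ⊢
    exact h.map_add_lineInj_of_map_add_eq (k.inv_mem ha) (k.inv_mem hb) (inv_injective.ne hab)
      (by rw [map_inv_add a ha ha₀, map_inv_add b hb hb₀, hsab]) hw hws
  have factor : s⁻¹ + w = s⁻¹ * w * (s + w⁻¹) := by
    field_simp [hw.ne_zero]
    ring
  rw [factor, map_mul, map_mul, map_add_inv, map_inv₀, hs, inv_one, one_mul] at map_inv_add_w
  exact hw.map_ne_one ((mul_eq_right₀ hsa₀).1 map_inv_add_w)

theorem map_add_eq_of_map_add_eq (h : IsNondegenerateDependenceHom k f D) (ha : a ∈ k)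
    (hb : b ∈ k) (hab : a ≠ b) (hsab : f (s + a) = f (s + b)) (hsa₁ : f (s + a) ≠ 1)
    (hd : d ∈ k) : f (s + d) = f (s + a) := by
  have hsk := h.isTrivialOn.notMem_of_map_add_eq ha hab hsab hsa₁
  have hs₀ : ∀ c ∈ k, f (s + c) ≠ 0 := fun c hc => (map_ne_zero f).2 fun h₀ =>
    hsk (eq_neg_of_add_eq_zero_left h₀ ▸ k.neg_mem hc)
  have hsd₁ : f (s + d) ≠ 1 := fun hsd => hsa₁ (by
    have ne_d : ∀ c, f (s + c) ≠ 1 → c - d ≠ 0 := fun c hc hcd =>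
      hc (by rwa [sub_eq_zero.1 hcd])
    have add_sub : ∀ c, s + d + (c - d) = s + c := fun c => by ring
    have := h.map_add_eq_one_of_map_eq_one hsd (k.sub_mem ha hd) (ne_d a hsa₁) (k.sub_mem hb hd)
      (ne_d b (hsab ▸ hsa₁)) (sub_left_injective.ne hab) (by rwa [add_sub, add_sub])
    rwa [add_sub] at this)
  obtain ⟨w, hw, hws⟩ := h.exists_lineInj_not_dep (hs₀ a ha) hsa₁
  have map_add_w : f (s + d + w) = f (s + a) := by
    rw [add_assoc, add_comm d]
    exact h.map_add_lineInj_of_map_add_eq ha hb hab hsab (hw.add_mem hd)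
      (h.not_dep_add_mem hw hd hws)
  have dep_s : D (f (s + d)) (f (s + a)) := by
    simpa using h.dep_add (s + d) (a - d) (k.sub_mem ha hd)
  have dep_w := h.dep_add_div (v := w) ((map_ne_zero f).1 (hs₀ d hd))
  rw [map_add_w] at dep_w
  have not_dep : ¬ D (f (s + d)) (f w / f (s + d)) := fun hd' =>
    hws (h.trans (hs₀ d hd) hsd₁ (h.symm (h.of_div_right (hs₀ d hd) (h.refl _) hd')) dep_s)
  exact ((div_eq_one_iff_eq (hs₀ d hd)).1 (h.eq_one_of_dep not_dep (h.div_right dep_s (h.refl _))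
    (h.symm dep_w) (div_ne_zero (hs₀ a ha) (hs₀ d hd)))).symm

theorem lineInj_of_map_add_one_ne (h : IsNondegenerateDependenceHom k f D) (hx₀ : x ≠ 0)
    (hx₁ : f x ≠ 1) (hne₁ : f (x + 1) ≠ 1) (hne : f (x + 1) ≠ f x) : LineInj k f x := by
  have hfx : f x ≠ 0 := (map_ne_zero f).2 hx₀
  have map_ne_one : ∀ c ∈ k, f (x + c) ≠ 1 := by
    intro c hc hxc
    have hc₀ : c ≠ 0 := by
      rintro rfl
      exact hx₁ (by rwa [add_zero] at hxc)
    have hinv : f (x⁻¹ + 0) = f (x⁻¹ + c⁻¹) := by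
      rw [h.isTrivialOn.map_inv_add hx₀ (k.inv_mem hc) (inv_ne_zero hc₀), inv_inv, hxc, add_zero,
        map_inv₀, one_div]
    have hinv_one := h.map_add_eq_of_map_add_eq k.zero_mem (k.inv_mem hc) (inv_ne_zero hc₀).symm
      hinv (by simpa using hx₁) k.one_mem
    rw [h.isTrivialOn.map_inv_add hx₀ k.one_mem one_ne_zero, inv_one, add_zero, map_inv₀,
      div_eq_iff hfx, inv_mul_cancel₀ hfx] at hinv_one
    exact hne₁ hinv_one
  refine ⟨map_ne_one, fun c hc d hd hcd => ?_⟩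
  by_contra hne_cd
  have map_eq : ∀ e ∈ k, f (x + e) = f (x + c) := fun e =>
    h.map_add_eq_of_map_add_eq hc hd hne_cd hcd (map_ne_one c hc)
  exact hne ((map_eq 1 k.one_mem).trans (by rw [← map_eq 0 k.zero_mem, add_zero]))

theorem prodInj_of_map_add_ne (h : IsNondegenerateDependenceHom k f D) (hu : u ≠ 0)
    (hv : ProdInj k f v) (huv : f u ≠ f v) (hne_u : f (u + v) ≠ f u) (hne_v : f (u + v) ≠ f v) :
    ProdInj k f u := by
  have hv₀ := hv.map_ne_zero
  have hdiv : u / v + 1 = (u + v) / v := by rw [add_div, div_self hv.ne_zero]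
  have := h.prodInj_mul (h.prodInj_of_lineInj (h.lineInj_of_map_add_one_ne (x := u / v)
    (div_ne_zero hu hv.ne_zero)
    (by rwa [map_div₀, Ne, div_eq_one_iff_eq hv₀])
    (by rwa [hdiv, map_div₀, Ne, div_eq_one_iff_eq hv₀])
    (by rwa [hdiv, map_div₀, map_div₀, Ne, div_left_inj' hv₀]))) hv
  rwa [div_mul_cancel₀ _ hv.ne_zero] at this

theorem prodInj_one_add_of_map_eq_one (h : IsNondegenerateDependenceHom k f D) (hx₀ : x ≠ 0)
    (hxP : ¬ ProdInj k f x) (hx₁ : f x ≠ 1) (hadd : f (1 + x) = 1) : ProdInj k f (1 + x) := by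
  obtain ⟨v, hv, hvx⟩ := h.exists_lineInj_not_dep ((map_ne_zero f).2 hx₀) hx₁
  have hv' := hv.add_mem k.one_mem
  have hv'x : f x ≠ f (v + 1) := (h.ne (h.not_dep_add_mem hv k.one_mem hvx)).symm
  have h_or : f (x + (v + 1)) = f x ∨ f (x + (v + 1)) = f (v + 1) := by
    by_contra! hne
    exact hxP (h.prodInj_of_map_add_ne hx₀ (h.prodInj_of_lineInj hv') hv'x hne.1 hne.2)
  rw [show x + (v + 1) = 1 + x + v by ring] at h_or
  have hne₁ : f (1 + x + v) ≠ 1 := by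
    rcases h_or with he | he <;> rw [he]
    exacts [hx₁, hv'.map_ne_one]
  have hne_v : f (1 + x + v) ≠ f v := by
    rcases h_or with he | he <;> rw [he]
    exacts [(h.ne hvx).symm, hv.map_add_ne k.one_mem one_ne_zero]
  exact h.prodInj_of_map_add_ne ((map_ne_zero f).1 (hadd ▸ one_ne_zero)) (h.prodInj_of_lineInj hv)
    (hadd ▸ hv.map_ne_one.symm) (hadd.symm ▸ hne₁) hne_v

theorem prodInj_one_add_or_of_map_ne_one (h : IsNondegenerateDependenceHom k f D) (hx₀ : x ≠ 0)
    (hxP : ¬ ProdInj k f x) (hx₁ : f x ≠ 1) : ProdInj k f (1 + x) ∨ ProdInj k f (1 + x⁻¹) := by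
  by_cases hadd : f (1 + x) = 1
  · exact .inl (h.prodInj_one_add_of_map_eq_one hx₀ hxP hx₁ hadd)
  have hadd_x : f (1 + x) = f x := by
    by_contra hne
    rw [add_comm] at hadd hne
    exact hxP (h.prodInj_of_map_add_ne hx₀ h.prodInj_one (by rwa [map_one]) hne (by rwa [map_one]))
  refine .inr (h.prodInj_one_add_of_map_eq_one (inv_ne_zero hx₀)
    (fun hP => hxP (inv_inv x ▸ hP.inv h.isTrivialOn)) (by simpa using hx₁) ?_)
  rw [show 1 + x⁻¹ = (1 + x) / x by rw [add_div, div_self hx₀, one_div, add_comm], map_div₀,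
    hadd_x, div_self ((map_ne_zero f).2 hx₀)]

theorem map_add_eq_of_prodInj_add (h : IsNondegenerateDependenceHom k f D) (hw : ProdInj k f w)
    (hwx : ProdInj k f (w + x)) (hxP : ¬ ProdInj k f x) : f (w + x) = f w := by
  by_contra hne
  exact hxP (add_sub_cancel_left w x ▸ h.prodInj_sub hwx hw hne)

theorem prodInj_one_add_of_lineInj_add (h : IsNondegenerateDependenceHom k f D)
    (hw : LineInj k f w) (hwx : ProdInj k f (w + x)) (hxP : ¬ ProdInj k f x) :
    ProdInj k f (1 + x) := by
  have hw' := hw.add_mem (k.neg_mem k.one_mem)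
  have hne : f (w + x) ≠ f (w + -1) := by
    rw [h.map_add_eq_of_prodInj_add (h.prodInj_of_lineInj hw) hwx hxP]
    exact (hw.map_add_ne (k.neg_mem k.one_mem) (by simp)).symm
  have := h.prodInj_sub hwx (h.prodInj_of_lineInj hw') hne
  rwa [show w + x - (w + -1) = 1 + x by ring] at this

theorem prodInj_one_add_or (h : IsNondegenerateDependenceHom k f D) (hx₀ : x ≠ 0)
    (hxP : ¬ ProdInj k f x) : ProdInj k f (1 + x) ∨ ProdInj k f (1 + x⁻¹) := by
  by_cases hx₁ : f x ≠ 1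
  · exact h.prodInj_one_add_or_of_map_ne_one hx₀ hxP hx₁
  push Not at hx₁
  obtain ⟨w, -, hw, -⟩ := h.exists_not_dep
  have hwP := h.prodInj_of_lineInj hw
  have hdivP : ¬ ProdInj k f (x / w) := fun hP =>
    hxP (div_mul_cancel₀ x hw.ne_zero ▸ h.prodInj_mul hP hwP)
  refine (h.prodInj_one_add_or_of_map_ne_one (div_ne_zero hx₀ hw.ne_zero) hdivP
    (by simpa [hx₁] using hw.map_ne_one)).imp (fun hP => ?_) (fun hP => ?_)
  · refine h.prodInj_one_add_of_lineInj_add hw ?_ hxP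
    have := h.prodInj_mul hwP hP
    rwa [mul_add, mul_one, mul_div_cancel₀ x hw.ne_zero] at this
  · have hwi := hw.inv h.isTrivialOn
    refine h.prodInj_one_add_of_lineInj_add hwi ?_
      (fun hP => hxP (inv_inv x ▸ hP.inv h.isTrivialOn))
    have := h.prodInj_mul (h.prodInj_of_lineInj hwi) hP
    rwa [mul_add, mul_one, inv_div, ← mul_div_assoc, inv_mul_cancel₀ hw.ne_zero, one_div] at this

theorem prodInj_add_of_map_ne_one (h : IsNondegenerateDependenceHom k f D)
    (hxP : ¬ ProdInj k f x) (hx : ProdInj k f (1 + x)) (hw : ProdInj k f w) (hw₁ : f w ≠ 1) :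
    ProdInj k f (w + x) := by
  have map_one_add := h.map_add_eq_of_prodInj_add h.prodInj_one hx hxP
  rw [map_one] at map_one_add
  have hw' := (h.lineInj_of_prodInj hw hw₁).add_mem k.one_mem
  have hwx : ProdInj k f (w + 1 + x) := by
    rw [add_assoc]
    exact h.prodInj_add hw hx (map_one_add ▸ hw₁)
  have hne : f (w + 1 + x) ≠ f 1 := by
    rw [h.map_add_eq_of_prodInj_add (h.prodInj_of_lineInj hw') hwx hxP, map_one]
    exact hw'.map_ne_one
  have := h.prodInj_sub hwx h.prodInj_one hne
  rwa [show w + 1 + x - 1 = w + x by ring] at this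

theorem prodInj_add_of_prodInj_one_add (h : IsNondegenerateDependenceHom k f D)
    (hxP : ¬ ProdInj k f x) (hx : ProdInj k f (1 + x)) (hw : ProdInj k f w) :
    ProdInj k f (w + x) := by
  by_cases hw₁ : f w ≠ 1
  · exact h.prodInj_add_of_map_ne_one hxP hx hw hw₁
  push Not at hw₁
  obtain ⟨v, -, hv, -⟩ := h.exists_not_dep
  have hvP := h.prodInj_of_lineInj hv
  have hvx := h.prodInj_add_of_map_ne_one hxP hx hvP hv.map_ne_one
  have hdiv := h.prodInj_add_of_map_ne_one (x := x / v) (w := w / v)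
    (fun hP => hxP (div_mul_cancel₀ x hv.ne_zero ▸ h.prodInj_mul hP hvP))
    (by rw [← div_self hv.ne_zero, ← add_div]; exact h.prodInj_div hvx hvP)
    (h.prodInj_div hw hvP) (by simpa [hw₁] using hv.map_ne_one)
  rw [← add_div] at hdiv
  exact div_mul_cancel₀ (w + x) hv.ne_zero ▸ h.prodInj_mul hdiv hvP

theorem isRigid_prodInjSubmonoid (h : IsNondegenerateDependenceHom k f D) :
    IsRigid h.prodInjSubmonoid := by
  have neg_one_mem : -1 ∈ h.prodInjSubmonoid := h.prodInj_one.neg h.isTrivialOn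
  have mem_of_one_add : ∀ x, x ∉ h.prodInjSubmonoid → 1 + x ∈ h.prodInjSubmonoid →
      x ∈ infinitesimals h.prodInjSubmonoid := fun x hxP hx =>
    mem_infinitesimals_of_forall_add_mem neg_one_mem fun w hw =>
      add_comm w x ▸ h.prodInj_add_of_prodInj_one_add hxP hx hw
  have inv_mem : ∀ x ∈ h.prodInjSubmonoid, x⁻¹ ∈ h.prodInjSubmonoid := fun x hx =>
    ProdInj.inv h.isTrivialOn hx
  refine ⟨fun h₀ => h₀.ne_zero rfl, neg_one_mem, inv_mem, fun x hx₀ hxP => ?_⟩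
  exact (h.prodInj_one_add_or hx₀ hxP).imp (mem_of_one_add x hxP)
    (mem_of_one_add x⁻¹ fun hP => hxP (inv_inv x ▸ inv_mem _ hP))

theorem map_one_add_of_mem_infinitesimals (h : IsNondegenerateDependenceHom k f D)
    (hx : x ∈ infinitesimals h.prodInjSubmonoid) : f (1 + x) = 1 := by
  rw [h.map_add_eq_of_prodInj_add h.prodInj_one (add_comm x 1 ▸ (mem_infinitesimals.1 hx 1).2
    (one_mem _)) (notMem_of_mem_infinitesimals h.isRigid_prodInjSubmonoid.zero_notMem hx), map_one]

end IsNondegenerateDependenceHom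

end Dependence

section AlgebraicDependence

open IntermediateField

section Field

variable {F : Type v} [Field F] {K : Type u} [Field K] [Algebra F K] {x y z : K}

open scoped IntermediateField.algebraAdjoinAdjoin in
theorem trdeg_adjoin_simple_le_one (x : K) : Algebra.trdeg F F⟮x⟯ ≤ 1 := by
  have trdeg_algebra_adjoin : Algebra.trdeg F (Algebra.adjoin F {x}) ≤ 1 := by
    let x' : Algebra.adjoin F {x} := ⟨x, Algebra.self_mem_adjoin_singleton F x⟩
    have surjective_aeval : Function.Surjective (Polynomial.aeval (R := F) x') := by
      rintro ⟨z, hz⟩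
      obtain ⟨p, rfl⟩ := Algebra.adjoin_singleton_eq_range_aeval F x ▸ hz
      exact ⟨p, Subtype.ext (by simp [x'])⟩
    simpa using lift_trdeg_le_of_surjective _ surjective_aeval
  have : FaithfulSMul F (Algebra.adjoin F {x}) :=
    (faithfulSMul_iff_algebraMap_injective _ _).2 (algebraMap F _).injective
  rwa [← trdeg_add_eq F (Algebra.adjoin F {x}) (A := F⟮x⟯),
    trdeg_eq_zero (R := Algebra.adjoin F {x}), add_zero]

theorem isAlgebraic_adjoin_simple_self (x : K) : IsAlgebraic F⟮x⟯ x :=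
  isAlgebraic_algebraMap (AdjoinSimple.gen F x)

theorem isAlgebraic_adjoin_simple_trans (hy : IsAlgebraic F⟮x⟯ y) (hz : IsAlgebraic F⟮y⟯ z) :
    IsAlgebraic F⟮x⟯ z := by
  rw [isAlgebraic_adjoin_iff] at *
  exact hz.adjoin_of_forall_isAlgebraic fun w hw => hw.1 ▸ hy

theorem trdeg_adjoin_pair_le_one (hy : IsAlgebraic F⟮x⟯ y) :
    Algebra.trdeg F (adjoin F {x, y}) ≤ 1 := by
  let C := algebraicClosure F⟮x⟯ K
  have adjoin_le : adjoin F {x, y} ≤ C.restrictScalars F := by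
    rw [adjoin_le_iff]
    rintro z (rfl | rfl)
    · exact mem_algebraicClosure_iff.2 (isAlgebraic_adjoin_simple_self z)
    · exact mem_algebraicClosure_iff.2 hy
  have : FaithfulSMul F F⟮x⟯ :=
    (faithfulSMul_iff_algebraMap_injective _ _).2 (algebraMap F _).injective
  have : FaithfulSMul F⟮x⟯ C :=
    (faithfulSMul_iff_algebraMap_injective _ _).2 (algebraMap F⟮x⟯ C).injective
  calc Algebra.trdeg F (adjoin F {x, y})
      ≤ Algebra.trdeg F C :=
        trdeg_le_of_injective (inclusion adjoin_le) (inclusion_injective adjoin_le)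
    _ = Algebra.trdeg F F⟮x⟯ := by
        rw [← trdeg_add_eq F F⟮x⟯ (A := C), trdeg_eq_zero (R := F⟮x⟯), add_zero]
    _ ≤ 1 := trdeg_adjoin_simple_le_one x

theorem isAlgebraic_of_trdeg_adjoin_pair_le_one (hx : Transcendental F x)
    (h : Algebra.trdeg F (adjoin F {x, y}) ≤ 1) : IsAlgebraic F⟮x⟯ y := by
  by_contra hy
  let x' : adjoin F {x, y} := ⟨x, subset_adjoin F _ (by simp)⟩
  let y' : adjoin F {x, y} := ⟨y, subset_adjoin F _ (by simp)⟩
  have hxy : AlgebraicIndependent F (fun o : Option Unit => o.elim y fun _ => x) := by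
    refine ((algebraicIndependent_unique_type_iff.2 hx).option_iff_transcendental y).2 ?_
    rw [Set.range_const]
    exact fun ha => hy (isAlgebraic_adjoin_iff.2 ha)
  have hxy' : AlgebraicIndependent F (fun o : Option Unit => o.elim y' fun _ => x') := by
    refine AlgebraicIndependent.of_comp (adjoin F {x, y}).val ?_
    convert hxy using 1
    ext o
    cases o <;> rfl
  have two_le_one := hxy'.lift_cardinalMk_le_trdeg.trans (Cardinal.lift_le.2 h)
  simp at two_le_one

end Field

variable {L : Type v} [Field L] {F : Subfield L} {a b c : Lˣ ⧸ unitsOf F}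

theorem mk_unitsOf_eq_one {x : Lˣ} : (x : Lˣ ⧸ unitsOf F) = 1 ↔ (x : L) ∈ F := by
  rw [QuotientGroup.eq_one_iff, mem_unitsOf]

theorem adjoin_pair_le_of_mk_eq {x y x' y' : Lˣ} (hx : (x : Lˣ ⧸ unitsOf F) = x')
    (hy : (y : Lˣ ⧸ unitsOf F) = y') :
    adjoin F {(x : L), (y : L)} ≤ adjoin F {(x' : L), (y' : L)} := by
  have mem_of_mk_eq : ∀ {z z' : Lˣ} (E : IntermediateField F L), (z : Lˣ ⧸ unitsOf F) = z' →
      (z' : L) ∈ E → (z : L) ∈ E := by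
    intro z z' E h hz'
    have hc : ((z'⁻¹ * z : Lˣ) : L) ∈ F := mem_unitsOf.1 (QuotientGroup.eq.1 h.symm)
    rw [← mul_inv_cancel_left z' z, Units.val_mul]
    exact E.mul_mem hz' (E.algebraMap_mem ⟨_, hc⟩)
  rw [adjoin_le_iff]
  rintro z (rfl | rfl)
  · exact mem_of_mk_eq _ hx (subset_adjoin F _ (by simp))
  · exact mem_of_mk_eq _ hy (subset_adjoin F _ (by simp))

theorem algDep_mk {x y : Lˣ} : AlgDep F (x : Lˣ ⧸ unitsOf F) (y : Lˣ ⧸ unitsOf F) ↔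
    Algebra.trdeg F (adjoin F {(x : L), (y : L)}) ≤ 1 := by
  refine ⟨fun ⟨x', y', hx, hy, h⟩ => ?_, fun h => ⟨x, y, rfl, rfl, h⟩⟩
  rwa [le_antisymm (adjoin_pair_le_of_mk_eq hx.symm hy.symm) (adjoin_pair_le_of_mk_eq hx hy)]

theorem AlgDep.symm {H : Subgroup Lˣ} {a b : Lˣ ⧸ H} (h : AlgDep F a b) : AlgDep F b a := by
  obtain ⟨x, y, hx, hy, h⟩ := h
  refine ⟨y, x, hy, hx, ?_⟩
  rwa [Set.pair_comm]

theorem algDep_refl (a : Lˣ ⧸ unitsOf F) : AlgDep F a a := by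
  obtain ⟨x, rfl⟩ := QuotientGroup.mk_surjective a
  exact algDep_mk.2 (trdeg_adjoin_pair_le_one (isAlgebraic_adjoin_simple_self _))

theorem algDep_one_left (b : Lˣ ⧸ unitsOf F) : AlgDep F 1 b := by
  obtain ⟨y, rfl⟩ := QuotientGroup.mk_surjective b
  exact AlgDep.symm (algDep_mk (y := 1).2 (trdeg_adjoin_pair_le_one isAlgebraic_one))

theorem algDep_iff_isAlgebraic (hF : ∀ y : L, IsAlgebraic F y → y ∈ F) {x y : Lˣ} :
    AlgDep F (x : Lˣ ⧸ unitsOf F) (y : Lˣ ⧸ unitsOf F) ↔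
      (x : Lˣ ⧸ unitsOf F) = 1 ∨ IsAlgebraic F⟮(x : L)⟯ (y : L) := by
  refine ⟨fun h => or_iff_not_imp_left.2 fun hx => ?_, ?_⟩
  · rw [mk_unitsOf_eq_one] at hx
    exact isAlgebraic_of_trdeg_adjoin_pair_le_one (fun ha => hx (hF _ ha)) (algDep_mk.1 h)
  · rintro (h | h)
    · exact h ▸ algDep_one_left _
    · exact algDep_mk.2 (trdeg_adjoin_pair_le_one h)

theorem AlgDep.trans (hF : ∀ y : L, IsAlgebraic F y → y ∈ F) (hb : b ≠ 1) (hab : AlgDep F a b)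
    (hbc : AlgDep F b c) : AlgDep F a c := by
  obtain ⟨x, rfl⟩ := QuotientGroup.mk_surjective a
  obtain ⟨y, rfl⟩ := QuotientGroup.mk_surjective b
  obtain ⟨z, rfl⟩ := QuotientGroup.mk_surjective c
  rw [algDep_iff_isAlgebraic hF] at *
  exact hab.imp_right fun h => isAlgebraic_adjoin_simple_trans h (hbc.resolve_left hb)

theorem AlgDep.mul_right (hF : ∀ y : L, IsAlgebraic F y → y ∈ F) (hab : AlgDep F a b)
    (hac : AlgDep F a c) : AlgDep F a (b * c) := by
  obtain ⟨x, rfl⟩ := QuotientGroup.mk_surjective a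
  obtain ⟨y, rfl⟩ := QuotientGroup.mk_surjective b
  obtain ⟨z, rfl⟩ := QuotientGroup.mk_surjective c
  rw [← QuotientGroup.mk_mul]
  rw [algDep_iff_isAlgebraic hF] at *
  rw [Units.val_mul]
  exact hab.elim Or.inl fun hy => hac.imp_right hy.mul

theorem AlgDep.inv_right (hF : ∀ y : L, IsAlgebraic F y → y ∈ F) (hab : AlgDep F a b) :
    AlgDep F a b⁻¹ := by
  obtain ⟨x, rfl⟩ := QuotientGroup.mk_surjective a
  obtain ⟨y, rfl⟩ := QuotientGroup.mk_surjective b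
  rw [← QuotientGroup.mk_inv]
  rw [algDep_iff_isAlgebraic hF] at *
  rw [Units.val_inv_eq_inv_val]
  exact hab.imp_right IsAlgebraic.inv

/-- Algebraic dependence modulo `Fˣ`, extended to a group with zero by letting `0` depend on
everything. -/
def AlgDepZero (F : Subfield L) (a b : WithZero (Lˣ ⧸ unitsOf F)) : Prop :=
  ∀ a' b' : Lˣ ⧸ unitsOf F, a = a' → b = b' → AlgDep F a' b'

theorem algDepZero_coe :
    AlgDepZero F (a : WithZero (Lˣ ⧸ unitsOf F)) b ↔ AlgDep F a b := by
  refine ⟨fun h => h a b rfl rfl, fun h a' b' ha hb => ?_⟩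
  rwa [← WithZero.coe_inj.1 ha, ← WithZero.coe_inj.1 hb]

theorem isDependence_algDepZero (hF : ∀ y : L, IsAlgebraic F y → y ∈ F) :
    IsDependence (AlgDepZero F) where
  zero_left b a' b' ha _ := absurd ha.symm WithZero.coe_ne_zero
  one_left b a' b' ha _ := by
    rw [← WithZero.coe_one, WithZero.coe_inj] at ha
    exact ha ▸ algDep_one_left b'
  refl a a' b' ha hb := by
    rw [ha, WithZero.coe_inj] at hb
    exact hb ▸ algDep_refl a'
  symm h a' b' ha hb := (h b' a' hb ha).symm
  trans {a b c} hb₀ hb hab hbc a' c' ha hc := by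
    obtain ⟨b', rfl⟩ := WithZero.ne_zero_iff_exists.1 hb₀
    exact AlgDep.trans hF (fun h => hb (WithZero.coe_inj.2 h)) (hab a' b' ha rfl)
      (hbc b' c' rfl hc)
  mul_right {a b c} hab hac a' d' ha hd := by
    have h0 : b * c ≠ 0 := hd ▸ WithZero.coe_ne_zero
    obtain ⟨b', rfl⟩ := WithZero.ne_zero_iff_exists.1 (left_ne_zero_of_mul h0)
    obtain ⟨c', rfl⟩ := WithZero.ne_zero_iff_exists.1 (right_ne_zero_of_mul h0)
    rw [← WithZero.coe_mul, WithZero.coe_inj] at hd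
    exact hd ▸ (hab a' b' ha rfl).mul_right hF (hac a' c' ha rfl)
  inv_right {a b} hab a' d' ha hd := by
    have h0 : b ≠ 0 := inv_eq_zero.not.1 (hd ▸ WithZero.coe_ne_zero)
    obtain ⟨b', rfl⟩ := WithZero.ne_zero_iff_exists.1 h0
    rw [← WithZero.coe_inv, WithZero.coe_inj] at hd
    exact hd ▸ (hab a' b' ha rfl).inv_right hF

end AlgebraicDependence

section Lines

variable {K : Type u} [Field K]

/-- The map `f` is injective on the projective subspace over `k` given by `V`. -/
def ProjInj {G : Type w} [CommGroupWithZero G] (k : Subfield K) (f : K →*₀ G)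
    (V : Submodule k K) : Prop :=
  ∀ v ∈ V, ∀ w ∈ V, v ≠ 0 → w ≠ 0 → f v = f w → v / w ∈ k

section

variable {G : Type w} [CommGroupWithZero G] {k : Subfield K} {f : K →*₀ G} {V : Submodule k K}
  {x : K}

theorem ProjInj.lineInj (hV : ProjInj k f V) (h1 : 1 ∈ V) (hx : x ∈ V) (hxk : x ∉ k) :
    LineInj k f x := by
  have add_mem : ∀ c ∈ k, x + c ∈ V := fun c hc => by
    simpa [Subfield.smul_def] using V.add_mem hx (V.smul_mem (⟨c, hc⟩ : k) h1)
  have add_notMem : ∀ c ∈ k, x + c ∉ k := fun c hc h => hxk (by simpa using k.sub_mem h hc)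
  have add_ne_zero : ∀ c ∈ k, x + c ≠ 0 := fun c hc h => add_notMem c hc (h ▸ k.zero_mem)
  refine ⟨fun c hc hxc => ?_, fun c hc d hd hcd => ?_⟩
  · refine add_notMem c hc ?_
    simpa using hV _ (add_mem c hc) 1 h1 (add_ne_zero c hc) one_ne_zero (by rwa [map_one])
  · by_contra hne
    have hxd := add_ne_zero d hd
    have ratio_mem : (c - d) / (x + d) ∈ k := by
      have := k.sub_mem (hV _ (add_mem c hc) _ (add_mem d hd) (add_ne_zero c hc) hxd hcd) k.one_mem
      rwa [div_sub_one hxd, add_sub_add_left_eq_sub] at this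
    refine add_notMem d hd ?_
    simpa [div_div_cancel₀ (sub_ne_zero.2 hne)] using k.div_mem (k.sub_mem hc hd) ratio_mem

theorem mem_span_one_pair {v : K} :
    v ∈ Submodule.span k {1, x} ↔ ∃ a ∈ k, ∃ b ∈ k, a + b * x = v := by
  simp [Submodule.mem_span_pair, Subfield.smul_def]

theorem finrank_span_one_pair (hxk : x ∉ k) : Module.finrank k (Submodule.span k {1, x}) = 2 := by
  have linearIndependent : LinearIndependent k ![(1 : K), x] := by
    rw [LinearIndependent.pair_iff' one_ne_zero]
    rintro a rfl
    exact hxk (by simp [Subfield.smul_def])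
  rw [← Matrix.range_cons_cons_empty 1 x ![], finrank_span_eq_card linearIndependent,
    Fintype.card_fin]

theorem LineInj.projInj_span (hx : LineInj k f x) (hf : IsTrivialOn k f) :
    ProjInj k f (Submodule.span k {1, x}) := by
  have mem_or_eq : ∀ v ∈ Submodule.span k {1, x},
      v ∈ k ∨ ∃ b ∈ k, b ≠ 0 ∧ ∃ c ∈ k, v = b * (x + c) := by
    intro v hv
    obtain ⟨a, ha, b, hb, rfl⟩ := mem_span_one_pair.1 hv
    by_cases hb₀ : b = 0
    · exact Or.inl (by simpa [hb₀] using ha)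
    · refine Or.inr ⟨b, hb, hb₀, a / b, k.div_mem ha hb, ?_⟩
      field_simp
      ring
  intro v hv w hw hv₀ hw₀ hvw
  rcases mem_or_eq v hv with hvk | ⟨b, hb, hb₀, c, hc, rfl⟩ <;>
    rcases mem_or_eq w hw with hwk | ⟨b', hb', hb₀', c', hc', rfl⟩
  · exact k.div_mem hvk hwk
  · rw [hf.map_mul_of_mem hb' hb₀', hf v hvk hv₀] at hvw
    exact absurd hvw.symm (hx.1 c' hc')
  · rw [hf.map_mul_of_mem hb hb₀, hf w hwk hw₀] at hvw
    exact absurd hvw (hx.1 c hc)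
  · rw [hf.map_mul_of_mem hb hb₀, hf.map_mul_of_mem hb' hb₀'] at hvw
    rw [hx.2 c hc c' hc' hvw, mul_div_mul_right _ _ (right_ne_zero_of_mul hw₀)]
    exact k.div_mem hb hb'

end

variable {A : Type v} [CommGroup A]

open scoped Classical in
/-- A homomorphism on `ℙ(K)`, extended by zero to a multiplicative map on `K`. -/
noncomputable def extendZero (ψ : PK K →* A) : K →*₀ WithZero A where
  toFun x := if hx : x = 0 then 0 else (ψ (Units.mk0 x hx : Kˣ) : WithZero A)
  map_zero' := by simp
  map_one' := by simp
  map_mul' x y := by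
    by_cases hx : x = 0
    · simp [hx]
    by_cases hy : y = 0
    · simp [hy]
    simp [hx, hy, Units.mk0_mul]

variable {ψ : PK K →* A}

theorem extendZero_mk0 {x : K} (hx : x ≠ 0) :
    extendZero ψ x = (ψ (Units.mk0 x hx : Kˣ) : WithZero A) := by
  simp [extendZero, hx]

theorem extendZero_unit (x : Kˣ) : extendZero ψ (x : K) = (ψ (x : PK K) : WithZero A) := by
  rw [extendZero_mk0 x.ne_zero, Units.mk0_val]

theorem isTrivialOn_extendZero (ψ : PK K →* A) : IsTrivialOn (PrimeField K) (extendZero ψ) := by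
  intro c hc hc₀
  rw [extendZero_mk0 hc₀, mk_unitsOf_eq_one.2 hc, map_one, WithZero.coe_one]

theorem injective_restrict_iff {V : Submodule (PrimeField K) K} :
    Function.Injective (restrict ψ V) ↔ ProjInj (PrimeField K) (extendZero ψ) V := by
  have extendZero_eq_iff : ∀ {v w : V} (hv : v ≠ 0) (hw : w ≠ 0),
      extendZero ψ (v : K) = extendZero ψ (w : K) ↔
        restrict ψ V (Projectivization.mk _ v hv) = restrict ψ V (Projectivization.mk _ w hw) := by
    intro v w hv hw
    rw [extendZero_mk0 (Subtype.coe_ne_coe.2 hv), extendZero_mk0 (Subtype.coe_ne_coe.2 hw),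
      WithZero.coe_inj]
    rfl
  constructor
  · intro hinj v hv w hw hv₀ hw₀ hvw
    have hv' : (⟨v, hv⟩ : V) ≠ 0 := fun h => hv₀ (congrArg Subtype.val h)
    have hw' : (⟨w, hw⟩ : V) ≠ 0 := fun h => hw₀ (congrArg Subtype.val h)
    obtain ⟨a, ha⟩ := (Projectivization.mk_eq_mk_iff' _ _ _ hv' hw').1
      (hinj ((extendZero_eq_iff hv' hw').1 hvw))
    have hav : (a : K) * w = v := congrArg Subtype.val ha
    rw [← hav, mul_div_cancel_right₀ _ hw₀]
    exact a.2
  · intro hV P Q hPQ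
    induction P with | h v hv => ?_
    induction Q with | h w hw => ?_
    have hw' : (w : K) ≠ 0 := Subtype.coe_ne_coe.2 hw
    have hvw := hV v v.2 w w.2 (Subtype.coe_ne_coe.2 hv) hw' ((extendZero_eq_iff hv hw).2 hPQ)
    exact (Projectivization.mk_eq_mk_iff' _ _ _ hv hw).2
      ⟨⟨_, hvw⟩, Subtype.ext (div_mul_cancel₀ _ hw')⟩

theorem one_mem_of_one_mem_points {V : Submodule (PrimeField K) K}
    (h : (1 : PK K) ∈ points V) : (1 : K) ∈ V := by
  obtain ⟨u, huV, hu⟩ := h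
  simpa [Subfield.smul_def] using
    V.smul_mem (⟨(u : K), mk_unitsOf_eq_one.1 hu⟩⁻¹ : PrimeField K) huV

theorem exists_lineInj_of_mem_smallU {P : PK K} (hP : P ∈ smallU ψ) (hP₁ : ψ P ≠ 1) :
    ∃ x : Kˣ, (x : PK K) = P ∧ LineInj (PrimeField K) (extendZero ψ) x := by
  obtain ⟨V, -, h1, hinj, x, hxV, rfl⟩ := hP
  refine ⟨x, rfl, (injective_restrict_iff.1 hinj).lineInj (one_mem_of_one_mem_points h1) hxV ?_⟩
  exact fun hxk => hP₁ (by rw [mk_unitsOf_eq_one.2 hxk, map_one])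

theorem mem_smallU_of_lineInj {x : Kˣ} (hx : LineInj (PrimeField K) (extendZero ψ) x) :
    (x : PK K) ∈ smallU ψ :=
  ⟨Submodule.span _ {1, (x : K)}, finrank_span_one_pair hx.notMem,
    ⟨1, Submodule.subset_span (by simp), rfl⟩,
    injective_restrict_iff.2 (hx.projInj_span (isTrivialOn_extendZero ψ)),
    x, Submodule.subset_span (by simp), rfl⟩

theorem mem_bigU_of_prodInj {x : Kˣ} (hx : ProdInj (PrimeField K) (extendZero ψ) x) :
    (x : PK K) ∈ bigU ψ := by
  obtain ⟨y, z, hy, hz, hyz⟩ := hx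
  lift y to Kˣ using hy.ne_zero.isUnit
  lift z to Kˣ using hz.ne_zero.isUnit
  obtain rfl : x = y * z := Units.ext hyz
  exact ⟨_, mem_smallU_of_lineInj hy, _, mem_smallU_of_lineInj hz, QuotientGroup.mk_mul ..⟩

end Lines

section AlgebraicDependenceHom

open IntermediateField

variable {K : Type u} [Field K] {L : Type v} [Field L] {kt : Subfield K} {lt : Subfield L}
  {ψ : PK K →* Lˣ ⧸ unitsOf lt}

theorem isDependenceHom_extendZero (hlt : ∀ y : L, IsAlgebraic lt y → y ∈ lt)
    (hψ : PreservesAlgDep kt lt ψ) :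
    IsDependenceHom (PrimeField K) (extendZero ψ) (AlgDepZero lt) where
  toIsDependence := isDependence_algDepZero hlt
  isTrivialOn := isTrivialOn_extendZero (A := Lˣ ⧸ unitsOf lt) ψ
  dep_add x c hc := by
    have hD := isDependence_algDepZero hlt
    rcases eq_or_ne x 0 with rfl | hx
    · rw [map_zero]
      exact hD.zero_left _
    rcases eq_or_ne (x + c) 0 with hxc | hxc
    · rw [hxc, map_zero]
      exact hD.zero_right
    have isAlgebraic_add : IsAlgebraic kt⟮x⟯ (x + c) :=
      (isAlgebraic_adjoin_simple_self x).add
        (isAlgebraic_algebraMap (algebraMap kt kt⟮x⟯ ⟨c, (bot_le : PrimeField K ≤ kt) hc⟩))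
    rw [extendZero_mk0 hx, extendZero_mk0 hxc, algDepZero_coe]
    exact hψ _ _ ⟨_, _, rfl, rfl, trdeg_adjoin_pair_le_one isAlgebraic_add⟩

theorem isNondegenerateDependenceHom_extendZero (hlt : ∀ y : L, IsAlgebraic lt y → y ∈ lt)
    (hψ : PreservesAlgDep kt lt ψ)
    (hgen : ∃ y₁ ∈ ψ '' smallU ψ, ∃ y₂ ∈ ψ '' smallU ψ, ¬ AlgDep lt y₁ y₂) :
    IsNondegenerateDependenceHom (PrimeField K) (extendZero ψ) (AlgDepZero lt) where
  toIsDependenceHom := isDependenceHom_extendZero hlt hψ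
  exists_not_dep := by
    obtain ⟨-, ⟨P, hP, rfl⟩, -, ⟨Q, hQ, rfl⟩, hPQ⟩ := hgen
    have hP₁ : ψ P ≠ 1 := fun h => hPQ (h ▸ algDep_one_left _)
    have hQ₁ : ψ Q ≠ 1 := fun h => hPQ (h ▸ (algDep_one_left _).symm)
    obtain ⟨x, rfl, hx⟩ := exists_lineInj_of_mem_smallU (A := Lˣ ⧸ unitsOf lt) (ψ := ψ) hP hP₁
    obtain ⟨y, rfl, hy⟩ := exists_lineInj_of_mem_smallU (A := Lˣ ⧸ unitsOf lt) (ψ := ψ) hQ hQ₁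
    refine ⟨x, y, hx, hy, ?_⟩
    rwa [extendZero_unit, extendZero_unit, algDepZero_coe]

end AlgebraicDependenceHom

end AlgDepHom

theorem mainTheorem7_general {K : Type u} [Field K] {L : Type v} [Field L]
    (kt : Subfield K) (lt : Subfield L)
    (hlt : ∀ y : L, IsAlgebraic lt y → y ∈ lt)
    (ψ : AlgDepHom.PK K →* Lˣ ⧸ AlgDepHom.unitsOf lt)
    (hψ : AlgDepHom.PreservesAlgDep kt lt ψ)
    (hgen : ∃ y₁ ∈ ψ '' AlgDepHom.smallU ψ, ∃ y₂ ∈ ψ '' AlgDepHom.smallU ψ,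
      ¬ AlgDepHom.AlgDep lt y₁ y₂) :
    ∃ (Γ : Type u) (_ : LinearOrderedCommGroupWithZero Γ) (ν : Valuation K Γ),
      Function.Surjective ν ∧
      (∀ x : Kˣ, ν x = 1 → (x : AlgDepHom.PK K) ∈ AlgDepHom.bigU ψ) ∧
      (∀ x : Kˣ, ν ((x : K) - 1) < 1 → ψ (x : AlgDepHom.PK K) = 1) := by
  have h := AlgDepHom.isNondegenerateDependenceHom_extendZero hlt hψ hgen
  have rigid := h.isRigid_prodInjSubmonoid
  refine ⟨rigid.valuationSubring.ValueGroup, inferInstance, rigid.valuationSubring.valuation,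
    rigid.valuationSubring.valuation_surjective, fun x hx => ?_, fun x hx => ?_⟩
  · exact AlgDepHom.mem_bigU_of_prodInj (rigid.mem_of_valuation_eq_one hx)
  · have map_x := h.map_one_add_of_mem_infinitesimals
      (rigid.mem_infinitesimals_of_valuation_lt_one hx)
    rwa [add_sub_cancel, AlgDepHom.extendZero_unit, ← WithZero.coe_one, WithZero.coe_inj] at map_x

theorem mainTheorem7 {K : Type u} [Field K] {L : Type v} [Field L]
    (kt : Subfield K) (lt : Subfield L)
    (hlt : ∀ y : L, IsAlgebraic lt y → y ∈ lt)
    (ψ : AlgDepHom.PK K →* Lˣ ⧸ AlgDepHom.unitsOf lt)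
    (hψ : AlgDepHom.PreservesAlgDep kt lt ψ)
    (hgen : ∃ y₁ ∈ ψ '' AlgDepHom.smallU ψ, ∃ y₂ ∈ ψ '' AlgDepHom.smallU ψ,
      ¬ AlgDepHom.AlgDep lt y₁ y₂)
    (hF : ∃ V : Submodule (AlgDepHom.PrimeField K) K, AlgDepHom.IsTypeF ψ V) :
    ∃ (Γ : Type u) (_ : LinearOrderedCommGroupWithZero Γ) (ν : Valuation K Γ),
      Function.Surjective ν ∧
      (∀ x : Kˣ, ν x = 1 → (x : AlgDepHom.PK K) ∈ AlgDepHom.bigU ψ) ∧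
      (∀ x : Kˣ, ν ((x : K) - 1) < 1 → ψ (x : AlgDepHom.PK K) = 1) :=
  mainTheorem7_general kt lt hlt ψ hψ hgen
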